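/- Let $\mathbf C$ be an essentially small category with pushouts. A compact ordered space is a compact space with a partial order that is closed in the square; morphisms are the continuous order-preserving maps, and $\mathbf{KOrd}$ is the resulting category. A $\mathbf C$-adic compact ordered space is a functor $S:\mathbf C^{op}\to\mathbf{KOrd}$ such that - for every pushout square $n\to m\to p$, $n\to k\to p$ in $\mathbf C$ and all $b\in S(m)$, $c\in S(k)$ with $b|_n\le c|_n$ there is $a\in S(p)$ with $b\le a|_m$ and $a|_k\le c$ (here $|$ denotes the maps given by $S$); - for every $\sigma:n\to m$ the map $S(\sigma)$ is bounded, i.e. sends up-sets to up-sets. It is co-bounded if, for all $\sigma:n\to m$, $x\in S(m)$ and $y\in S(n)$ with $y\le S(\sigma)(x)$, there is $x'\le x$ with $S(\sigma)(x')=y$. For $X\in\mathrm{Ind}(\mathbf C)$, viewed as a presheaf of sets $n\mapsto X(n)=\mathrm{Hom}(n,X)$, let $S(X)$ be the set of $X$-types, i.e. natural transformations $X\to S$, ordered pointwise. A tree is a poset with a least element (its root) in which every principal down-set is linearly ordered; a sub-tree is a non-empty down-closed sub-poset. An order-respecting family in $S(X)$ indexed by $I$ is an order-preserving map $I\to S(X)$.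 For a poset $I$, an order-respecting family $(x_i)_{i\in I}$ in $S(X)$ is a constant domain ($\omega$-saturated) Kripke model if for all $i\in I$, $f:n\to m$ in $\mathbf C$, $p\in X(n)$ and $t\in S(m)$: - if $S(f)(t)\le x_i(p)$, there is $q\in X(m)$ with $q\circ f=p$ and $t\le x_i(q)$; - if $x_i(p)\le S(f)(t)$, there are $j\ge i$ and $q\in X(m)$ with $q\circ f=p$ and $x_j(q)=t$. **Proposition.** Let $S$ be a co-bounded $\mathbf C$-adic compact ordered space. Let $X\in\mathrm{Ind}(\mathbf C)$, let $I$ be a tree and let $(x_i)_{i\in I}$ be an order-respecting family in $S(X)$. Then there are a morphism $X\to Y$ in $\mathrm{Ind}(\mathbf C)$, a tree $J$ containing $I$ as a sub-tree, and a constant domain Kripke model $(y_j)_{j\in J}$ in $S(Y)$ such that for every $i\in I$ the composite $X\to Y\xrightarrow{y_i}S$ equals $x_i$. In particular, constant domain Kripke models are complete for $S$: for every $X\in\mathrm{Ind}(\mathbf C)$ and every $X$-type $x$ of $S$ there are a morphism $X\to Y$ and a constant domain Kripke model $(y_j)_{j\in J}$ in $S(Y)$, indexed by a tree $J$ with root $r$,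 such that the composite $X\to Y\xrightarrow{y_r}S$ equals $x$. -/

import Mathlib

open CategoryTheory CategoryTheory.Limits Opposite

universe v u

/-- A compact ordered space: a compact space with a partial order that is closed in the square. -/
structure KOrd : Type (v + 1) where
  carrier : Type v
  [top : TopologicalSpace carrier]
  [order : PartialOrder carrier]
  [compact : CompactSpace carrier]
  [closed : OrderClosedTopology carrier]

namespace KOrd

instance : CoeSort KOrd.{v} (Type v) := ⟨KOrd.carrier⟩

attribute [instance] KOrd.top KOrd.order KOrd.compact KOrd.closed

/-- Morphisms of compact ordered spaces: continuous order-preserving maps. -/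
@[ext]
structure Hom (A B : KOrd.{v}) where
  hom : A →Co B

instance : Category KOrd.{v} where
  Hom A B := Hom A B
  id A := ⟨ContinuousOrderHom.id A⟩
  comp f g := ⟨g.hom.comp f.hom⟩

instance : ConcreteCategory KOrd.{v} (fun A B => A →Co B) where
  hom f := f.hom
  ofHom f := ⟨f⟩

end KOrd

/-- The interpolation property of a lax square `u ∘ f ≤ v ∘ g` of ordered sets. -/
def HasInterpolation {A B C D : Type*} [Preorder B] [Preorder C] [Preorder D]
    (f : A → B) (g : A → C) (u : B → D) (v : C → D) : Prop :=
  ∀ (b : B) (c : C), u b ≤ v c → ∃ a : A, b ≤ f a ∧ g a ≤ c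

/-- A map between ordered sets is bounded if the direct image of any up-set is an up-set. -/
def IsBoundedMap {A B : Type*} [Preorder A] [Preorder B] (f : A → B) : Prop :=
  ∀ U : Set A, IsUpperSet U → IsUpperSet (f '' U)

section

variable {C : Type u} [Category.{v} C]

/-- A `C`-adic compact ordered space: a functor `Cᵒᵖ ⥤ KOrd` sending pushout squares to squares
with the interpolation property and every morphism to a bounded map. -/
structure IsPolyadic (S : Cᵒᵖ ⥤ KOrd.{v}) : Prop where
  interpolation : ∀ {n m k p : C} (f : n ⟶ m) (g : n ⟶ k) (inl : m ⟶ p) (inr : k ⟶ p),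
    IsPushout f g inl inr →
      HasInterpolation (S.map inl.op) (S.map inr.op) (S.map f.op) (S.map g.op)
  bounded : ∀ {n m : C} (f : n ⟶ m), IsBoundedMap (S.map f.op)

/-- Co-boundedness: if `y ≤ S(f)(x)` then there is `x' ≤ x` with `S(f)(x') = y`. -/
def IsCoBounded (S : Cᵒᵖ ⥤ KOrd.{v}) : Prop :=
  ∀ {n m : C} (f : n ⟶ m) (x : S.obj (op m)) (y : S.obj (op n)),
    y ≤ S.map f.op x → ∃ x' : S.obj (op m), x' ≤ x ∧ S.map f.op x' = y

/-- The set of morphisms `n ⟶ X` from an object of `C` to an ind-object, realized as the value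
at `n` of the presheaf of `X`. -/
abbrev Tuple (X : Ind C) (n : C) : Type v := ((Ind.inclusion C).obj X).obj (op n)

/-- Precomposition of `p : m ⟶ X` with `f : n ⟶ m`. -/
noncomputable abbrev Tuple.precomp {X : Ind C} {n m : C} (f : n ⟶ m) (p : Tuple X m) : Tuple X n :=
  ((Ind.inclusion C).obj X).map f.op p

/-- The `X`-types of `S`, that is, the points of `S(X)`: natural transformations from `X` to the
underlying presheaf of sets of `S`. -/
def XType (S : Cᵒᵖ ⥤ KOrd.{v}) (X : Ind C) : Type (max u v) :=
  (Ind.inclusion C).obj X ⟶ S ⋙ forget KOrd.{v}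

namespace XType

variable {S : Cᵒᵖ ⥤ KOrd.{v}} {X Y : Ind C}

/-- The composite `n ⟶ X ⟶ S`, as a point of `S(n)`. -/
noncomputable def eval (x : XType S X) {n : C} (p : Tuple X n) : S.obj (op n) :=
  NatTrans.app x (op n) p

theorem eval_injective {x y : XType S X}
    (h : ∀ (n : C) (p : Tuple X n), x.eval p = y.eval p) : x = y := by
  refine NatTrans.ext (funext fun n => ?_)
  ext p
  exact h n.unop p

/-- `X`-types are ordered pointwise. -/
noncomputable instance : PartialOrder (XType S X) where
  le x y := ∀ (n : C) (p : Tuple X n), x.eval p ≤ y.eval p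
  le_refl _ _ _ := le_rfl
  le_trans _ _ _ h h' n p := (h n p).trans (h' n p)
  le_antisymm _ _ h h' := eval_injective fun n p => le_antisymm (h n p) (h' n p)

/-- The map `S(Y) → S(X)` induced by `f : X ⟶ Y`, i.e. the composite `X ⟶ Y ⟶ S`. -/
noncomputable def restrict (f : X ⟶ Y) (y : XType S Y) : XType S X :=
  (Ind.inclusion C).map f ≫ y

end XType

/-- An order-respecting family of `X`-types is a constant domain (`ω`-saturated) Kripke model
with domain `X` if every existential problem can be solved at the same world, and every
universal problem at some later world. -/
structure IsConstantDomainModel {S : Cᵒᵖ ⥤ KOrd.{v}} {X : Ind C} {I : Type*} [PartialOrder I]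
    (x : I →o XType S X) : Prop where
  existential : ∀ (i : I) {n m : C} (f : n ⟶ m) (p : Tuple X n) (t : S.obj (op m)),
    S.map f.op t ≤ (x i).eval p →
      ∃ q : Tuple X m, Tuple.precomp f q = p ∧ t ≤ (x i).eval q
  universal : ∀ (i : I) {n m : C} (f : n ⟶ m) (p : Tuple X n) (t : S.obj (op m)),
    (x i).eval p ≤ S.map f.op t →
      ∃ j : I, i ≤ j ∧ ∃ q : Tuple X m, Tuple.precomp f q = p ∧ (x j).eval q = t

end

/-- A rooted tree: a poset with a least element in which every principal down-set is a chain. -/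
structure IsRootedTree (I : Type*) [PartialOrder I] : Prop where
  exists_root : ∃ r : I, ∀ i : I, r ≤ i
  isChain_Iic : ∀ i : I, IsChain (· ≤ ·) (Set.Iic i)

/-! The model is the union of an ω-chain of extensions, each solving every problem posed by the
previous family. An existential problem is solved at its own world. A universal one is solved at a
new leaf above its world, so the poset stays a tree and the old tree stays down-closed.

A single problem is handled by a pushout: interpolation gives a point over the pushout, and
boundedness corrects one of its two inequalities to an equality (`exists_solution_of_isPushout`).
This prescribes the new family at one index only. The other indices are supplied by
`IsRootedTree.exists_monotone_lift`: a monotone family on a tree lifts along a bounded and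
co-bounded map with one value prescribed. Boundedness lifts upwards and co-boundedness downwards.
The tree shape ensures that each new value has to be compared with only one earlier value, since the
indices below a given one form a chain.

Finitely many problems over one object of C are solved by iterating pushouts
(`exists_isFreeExtension`). For all problems over an ind-object, the finite stages form a directed
system; the solutions at each stage form a nonempty closed set in a product of compact Hausdorff
spaces, so a coherent choice exists (`exists_isSolved`).

In the union, a tuple and a world both come from some stage, so any problem posed there is solved at
the next one. -/

/-! ### Compactness and monotone maps -/

/-- A directed inverse system of compact Hausdorff spaces with nonempty closed subsets has a
compatible family of points of these subsets. -/
theorem exists_compatible_family {A : Type*} [Preorder A] [IsDirectedOrder A] [Nonempty A]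
    {B : A → Type*} [∀ a, TopologicalSpace (B a)] [∀ a, CompactSpace (B a)] [∀ a, T2Space (B a)]
    (r : ∀ {a b : A}, a ≤ b → B b → B a)
    (hr : ∀ {a b : A} (h : a ≤ b), Continuous (r h))
    (hcomp : ∀ {a b c : A} (h : a ≤ b) (h' : b ≤ c) (y : B c), r h (r h' y) = r (h.trans h') y)
    (G : ∀ a, Set (B a)) (hclosed : ∀ a, IsClosed (G a)) (hne : ∀ a, (G a).Nonempty)
    (hmaps : ∀ {a b : A} (h : a ≤ b), Set.MapsTo (r h) (G b) (G a)) :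
    ∃ y : ∀ a, B a, (∀ (a b : A) (h : a ≤ b), r h (y b) = y a) ∧ ∀ a, y a ∈ G a := by
  classical
  -- `K c` asks for compatibility only with the coordinate `c`. These sets decrease as `c` grows,
  -- and one is inhabited by restricting a point of `G c` downwards and filling the remaining
  -- coordinates arbitrarily.
  let K : A → Set (∀ a, B a) := fun c => {y | y c ∈ G c ∧ ∀ (a : A) (h : a ≤ c), r h (y c) = y a}
  have hK : ∀ c, IsClosed (K c) := by
    intro c
    refine IsClosed.inter ((hclosed c).preimage (continuous_apply c)) ?_
    have : {y : ∀ a, B a | ∀ (a : A) (h : a ≤ c), r h (y c) = y a} =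
        ⋂ (a : A) (h : a ≤ c), {y : ∀ a, B a | r h (y c) = y a} := by
      ext y; simp
    change IsClosed {y : ∀ a, B a | ∀ (a : A) (h : a ≤ c), r h (y c) = y a}
    rw [this]
    exact isClosed_iInter fun a => isClosed_iInter fun h =>
      isClosed_eq ((hr h).comp (continuous_apply c)) (continuous_apply a)
  have hanti : ∀ {c d : A}, c ≤ d → K d ⊆ K c := by
    rintro c d h y ⟨hy, hy'⟩
    refine ⟨hy' c h ▸ hmaps h hy, fun a h' => ?_⟩
    rw [← hy' c h, hcomp, hy']
  have hKne : ∀ c, (K c).Nonempty := by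
    intro c
    obtain ⟨g, hg⟩ := hne c
    refine ⟨fun a => if h : a ≤ c then r h g else (hne a).some, ?_, fun a h => ?_⟩
    · simpa using hmaps le_rfl hg
    · simp [h, hcomp]
  obtain ⟨y, hy⟩ := IsCompact.nonempty_iInter_of_directed_nonempty_isCompact_isClosed K
    (fun c d => by
      obtain ⟨e, he, he'⟩ := exists_ge_ge c d
      exact ⟨e, hanti he, hanti he'⟩) hKne (fun c => (hK c).isCompact) hK
  rw [Set.mem_iInter] at hy
  exact ⟨y, fun a b h => (hy b).2 a h, fun a => (hy a).1⟩

theorem MonotoneOn.update {T B : Type*} [PartialOrder T] [Preorder B] [DecidableEq T] {y : T → B}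
    {s : Set T} (hy : MonotoneOn y s) {k : T} {b : B} (hle : ∀ l ∈ s, l ≤ k → y l ≤ b)
    (hge : ∀ l ∈ s, k ≤ l → b ≤ y l) : MonotoneOn (Function.update y k b) (insert k s) := by
  intro i hi j hj hij
  rcases eq_or_ne i k with rfl | hik <;> rcases eq_or_ne j i with rfl | hji
  · exact le_rfl
  · rw [Function.update_self, Function.update_of_ne hji]
    exact hge j (hj.resolve_left hji) hij
  · exact le_rfl
  · have hi' := hi.resolve_left hik
    rw [Function.update_of_ne hik]
    rcases eq_or_ne j k with rfl | hjk
    · rw [Function.update_self]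
      exact hle i hi' hij
    · rw [Function.update_of_ne hjk]
      exact hy hi' (hj.resolve_left hjk) hij

/-! ### Lifting monotone families along trees -/

section TreeExtension

variable {A B T : Type*} [PartialOrder A] [PartialOrder B] [PartialOrder T] {r : B → A} {x : T → A}

/-- Everything below `i` is a chain, so the lift is built from `i` downwards: a minimal `k` is
removed, the rest is lifted, and co-boundedness puts a lift of `x k` below the value at the least
remaining index. -/
theorem exists_monotoneOn_lift_of_lt (hdown : ∀ b a, a ≤ r b → ∃ b' ≤ b, r b' = a)
    (hchain : ∀ i : T, IsChain (· ≤ ·) (Set.Iic i)) (hx : Monotone x) (i : T)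
    {y : T → B} (hy : ∀ j, r (y j) = x j) (F : Finset T) (hF : ∀ k ∈ F, k < i) :
    ∃ y' : T → B, (∀ j, r (y' j) = x j) ∧ y' i = y i ∧ MonotoneOn y' (insert i (F : Set T)) := by
  classical
  induction hn : F.card generalizing F with
  | zero =>
    rw [Finset.card_eq_zero] at hn
    subst hn
    exact ⟨y, hy, rfl, by simp⟩
  | succ n ih =>
    have hFne : F.Nonempty := Finset.card_pos.1 (by lia)
    obtain ⟨k, hk⟩ := F.exists_minimal hFne
    obtain ⟨z, hz, hzi, hzm⟩ := ih (F.erase k) (fun l hl => hF l (Finset.mem_of_mem_erase hl))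
      (by rw [Finset.card_erase_of_mem hk.1, hn]; rfl)
    obtain ⟨m, hm⟩ := (insert i (F.erase k)).exists_minimal ⟨i, by simp⟩
    have hle : ∀ l ∈ insert i (F.erase k), l ≤ i := by
      intro l hl
      rcases Finset.mem_insert.1 hl with rfl | hl
      · exact le_rfl
      · exact (hF l (Finset.mem_of_mem_erase hl)).le
    have hmin : ∀ l ∈ insert i (F.erase k), m ≤ l := by
      intro l hl
      rcases (hchain i).total (hle m hm.1) (hle l hl) with h | h
      · exact h
      · exact hm.2 hl h
    have hki := hF k hk.1
    have hkm : k < m := by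
      rcases Finset.mem_insert.1 hm.1 with rfl | h
      · exact hki
      · rcases (hchain i).total hki.le (hle m hm.1) with h' | h'
        · exact lt_of_le_of_ne h' (Finset.ne_of_mem_erase h).symm
        · exact absurd (le_antisymm h' (hk.2 (Finset.mem_of_mem_erase h) h'))
            (Finset.ne_of_mem_erase h)
    obtain ⟨b, hb, hb'⟩ := hdown (z m) (x k) (by rw [hz]; exact hx hkm.le)
    refine ⟨Function.update z k b, fun j => ?_, ?_, ?_⟩
    · rcases eq_or_ne j k with rfl | hj
      · rw [Function.update_self, hb']
      · rw [Function.update_of_ne hj, hz]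
    · rw [Function.update_of_ne hki.ne', hzi]
    · have hmem : m ∈ insert i ((F.erase k : Finset T) : Set T) := by simpa [and_comm] using hm.1
      refine (hzm.update (k := k) (b := b) (fun l hl hlk => ?_) fun l hl _ => ?_).mono ?_
      · have := hmin l (by simpa [and_comm] using hl)
        exact absurd (hkm.trans_le this) hlk.not_gt
      · exact hb.trans (hzm hmem hl (hmin l (by simpa [and_comm] using hl)))
      · intro l hl
        by_cases h : l = k <;> simp_all

/-- Indices not below `i` are added upwards. A maximal such `k` has no remaining index above it, and
the remaining indices below it form a chain, so boundedness applied at the greatest of these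
suffices. The root in `F` guarantees that such a greatest index exists. -/
theorem exists_monotoneOn_lift (hup : ∀ b a, r b ≤ a → ∃ b' ≥ b, r b' = a)
    (hdown : ∀ b a, a ≤ r b → ∃ b' ≤ b, r b' = a)
    (hchain : ∀ i : T, IsChain (· ≤ ·) (Set.Iic i)) {r₀ : T} (hr₀ : ∀ i, r₀ ≤ i)
    (hx : Monotone x) (i : T) {y : T → B} (hy : ∀ j, r (y j) = x j) (F : Finset T)
    (hF : r₀ ∈ F) :
    ∃ y' : T → B, (∀ j, r (y' j) = x j) ∧ y' i = y i ∧ MonotoneOn y' (insert i (F : Set T)) := by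
  classical
  induction hn : F.card generalizing F with
  | zero => simp_all
  | succ n ih =>
    by_cases hall : ∀ k ∈ F, k ≤ i
    · obtain ⟨z, hz, hzi, hzm⟩ := exists_monotoneOn_lift_of_lt hdown hchain hx i hy (F.erase i)
        fun k hk => lt_of_le_of_ne (hall k (Finset.mem_of_mem_erase hk)) (Finset.ne_of_mem_erase hk)
      exact ⟨z, hz, hzi, hzm.mono fun l hl => by by_cases h : l = i <;> simp_all⟩
    · obtain ⟨k, hk⟩ := (F.filter fun k => ¬ k ≤ i).exists_maximal (by
        push Not at hall
        obtain ⟨k, hk, hk'⟩ := hall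
        exact ⟨k, by simp [hk, hk']⟩)
      have hkF : k ∈ F := (Finset.mem_filter.1 hk.1).1
      have hki : ¬ k ≤ i := (Finset.mem_filter.1 hk.1).2
      have hkr : r₀ ≠ k := fun h => hki (h ▸ hr₀ i)
      obtain ⟨z, hz, hzi, hzm⟩ := ih (F.erase k) (Finset.mem_erase.2 ⟨hkr, hF⟩)
        (by rw [Finset.card_erase_of_mem hkF, hn]; rfl)
      obtain ⟨m, hm⟩ := ((insert i (F.erase k)).filter (· ≤ k)).exists_maximal
        ⟨r₀, by simp [hkr, hF, hr₀]⟩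
      have hmk : m ≤ k := (Finset.mem_filter.1 hm.1).2
      have hmmem : m ∈ insert i ((F.erase k : Finset T) : Set T) := by
        have h := (Finset.mem_filter.1 hm.1).1
        simp only [Finset.mem_insert, Set.mem_insert_iff, Finset.mem_coe] at h ⊢
        exact h
      obtain ⟨b, hb, hb'⟩ := hup (z m) (x k) (by rw [hz]; exact hx hmk)
      refine ⟨Function.update z k b, fun j => ?_, ?_, ?_⟩
      · rcases eq_or_ne j k with rfl | hj
        · rw [Function.update_self, hb']
        · rw [Function.update_of_ne hj, hz]
      · rw [Function.update_of_ne (fun h => hki h.ge), hzi]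
      · refine (hzm.update (k := k) (b := b) (fun l hl hlk => ?_) fun l hl hkl => ?_).mono ?_
        · have hl' : l ∈ (insert i (F.erase k)).filter (· ≤ k) :=
            Finset.mem_filter.2 ⟨by simpa [and_comm] using hl, hlk⟩
          have : l ≤ m := ((hchain k).total hlk hmk).elim id fun h => hm.2 hl' h
          exact (hzm hl hmmem this).trans hb
        · rcases hl with rfl | hl
          · exact absurd hkl hki
          · have hl : l ∈ F.erase k := hl
            have hli : ¬ l ≤ i := fun h => hki (hkl.trans h)
            have := hk.2 (Finset.mem_filter.2 ⟨Finset.mem_of_mem_erase hl, hli⟩) hkl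
            exact absurd (le_antisymm this hkl) (Finset.ne_of_mem_erase hl)
        · intro l hl
          by_cases h : l = k <;> simp_all

/-- A monotone family indexed by a tree lifts along a bounded and co-bounded map of compact
ordered spaces, with prescribed lift at one index. -/
theorem IsRootedTree.exists_monotone_lift [TopologicalSpace A] [TopologicalSpace B] [T2Space A]
    [CompactSpace B] [OrderClosedTopology B] (hr : Continuous r)
    (hup : ∀ b a, r b ≤ a → ∃ b' ≥ b, r b' = a) (hdown : ∀ b a, a ≤ r b → ∃ b' ≤ b, r b' = a)
    (hT : IsRootedTree T) (hx : Monotone x) (i : T) (b : B) (hb : r b = x i) :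
    ∃ y : T → B, Monotone y ∧ (∀ j, r (y j) = x j) ∧ y i = b := by
  classical
  obtain ⟨r₀, hr₀⟩ := hT.exists_root
  obtain ⟨b₀, -, hb₀⟩ := hdown b (x r₀) (by rw [hb]; exact hx (hr₀ i))
  have hfib : ∀ j, ∃ c, r c = x j := fun j => by
    obtain ⟨c, -, hc⟩ := hup b₀ (x j) (by rw [hb₀]; exact hx (hr₀ j))
    exact ⟨c, hc⟩
  choose y₀ hy₀ using hfib
  let y₁ := Function.update y₀ i b
  have hy₁ : ∀ j, r (y₁ j) = x j := fun j => by
    rcases eq_or_ne j i with rfl | hj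
    · simp [y₁, hb]
    · simp [y₁, hj, hy₀]
  -- Monotonicity is imposed on finite sets only; compactness of the product then gives it
  -- everywhere.
  let K : Finset T → Set (T → B) := fun F =>
    {y | (∀ j, r (y j) = x j) ∧ y i = b ∧ MonotoneOn y F}
  have hK : ∀ F, IsClosed (K F) := by
    intro F
    refine IsClosed.inter ?_ (IsClosed.inter ?_ ?_)
    · change IsClosed {y : T → B | ∀ j, r (y j) = x j}
      simp only [Set.ofPred_forall]
      exact isClosed_iInter fun j =>
        isClosed_eq (hr.comp (continuous_apply j)) continuous_const
    · exact isClosed_eq (continuous_apply i) continuous_const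
    · change IsClosed {y : T → B | ∀ ⦃j⦄, j ∈ (F : Set T) → ∀ ⦃k⦄, k ∈ (F : Set T) → j ≤ k → y j ≤ y k}
      simp only [Set.ofPred_forall]
      exact isClosed_iInter fun j => isClosed_iInter fun _ => isClosed_iInter fun k =>
        isClosed_iInter fun _ => isClosed_iInter fun _ =>
          isClosed_le (continuous_apply j) (continuous_apply k)
  obtain ⟨y, hy⟩ := IsCompact.nonempty_iInter_of_directed_nonempty_isCompact_isClosed K
    (fun F F' => ⟨F ∪ F', fun y hy => ⟨hy.1, hy.2.1, hy.2.2.mono (by simp)⟩,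
      fun y hy => ⟨hy.1, hy.2.1, hy.2.2.mono (by simp)⟩⟩)
    (fun F => by
      obtain ⟨y, hy, hyi, hym⟩ := exists_monotoneOn_lift hup hdown hT.isChain_Iic hr₀ hx i hy₁
        (insert r₀ F) (by simp)
      exact ⟨y, hy, by simpa [y₁] using hyi, hym.mono fun l hl => by simp_all⟩)
    (fun F => (hK F).isCompact) hK
  rw [Set.mem_iInter] at hy
  refine ⟨y, fun j k hjk => ?_, (hy ∅).1, (hy ∅).2.1⟩
  exact (hy {j, k}).2.2 (by simp) (by simp) hjk

end TreeExtension

/-! ### Ind-objects as formal directed colimits -/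

section Presentation

variable {C : Type u} [Category.{v} C]

theorem KOrd.map_comp_apply (S : Cᵒᵖ ⥤ KOrd.{v}) {a b c : C} (f : a ⟶ b) (g : b ⟶ c)
    (t : S.obj (op c)) : S.map (f ≫ g).op t = S.map f.op (S.map g.op t) := by
  rw [op_comp, S.map_comp]
  rfl

theorem KOrd.map_id_apply (S : Cᵒᵖ ⥤ KOrd.{v}) {a : C} (t : S.obj (op a)) :
    S.map (𝟙 a).op t = t := by
  rw [op_id, S.map_id]
  rfl

theorem KOrd.monotone_map (S : Cᵒᵖ ⥤ KOrd.{v}) {a b : C} (f : a ⟶ b) : Monotone (S.map f.op) :=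
  (S.map f.op).hom.monotone

theorem KOrd.continuous_map (S : Cᵒᵖ ⥤ KOrd.{v}) {a b : C} (f : a ⟶ b) :
    Continuous (S.map f.op) :=
  map_continuous (S.map f.op).hom

theorem IsPolyadic.exists_ge {S : Cᵒᵖ ⥤ KOrd.{v}} (hS : IsPolyadic S) {n m : C} (f : n ⟶ m)
    (b : S.obj (op m)) (a : S.obj (op n)) (h : S.map f.op b ≤ a) : ∃ b' ≥ b, S.map f.op b' = a :=
  hS.bounded f (Set.Ici b) (isUpperSet_Ici b) h ⟨b, Set.self_mem_Ici, rfl⟩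

namespace Tuple

variable {X Y Z : Ind C}

theorem precomp_comp {n m k : C} (f : n ⟶ m) (g : m ⟶ k) (p : Tuple X k) :
    precomp (f ≫ g) p = precomp f (precomp g p) := by
  simp [precomp]

theorem precomp_id {n : C} (p : Tuple X n) : precomp (𝟙 n) p = p := by
  simp [precomp]

/-- The composite of a tuple with a morphism of ind-objects. -/
noncomputable def map (f : X ⟶ Y) {n : C} (p : Tuple X n) : Tuple Y n :=
  ((Ind.inclusion C).map f).app (op n) p

theorem map_precomp (f : X ⟶ Y) {n m : C} (g : n ⟶ m) (p : Tuple X m) :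
    map f (precomp g p) = precomp g (map f p) :=
  NatTrans.naturality_apply ((Ind.inclusion C).map f) g.op p

theorem map_comp (f : X ⟶ Y) (g : Y ⟶ Z) {n : C} (p : Tuple X n) :
    map (f ≫ g) p = map g (map f p) := by
  simp [map]

end Tuple

namespace XType

variable {S : Cᵒᵖ ⥤ KOrd.{v}} {X Y Z : Ind C}

theorem eval_precomp (x : XType S X) {n m : C} (g : n ⟶ m) (p : Tuple X m) :
    x.eval (Tuple.precomp g p) = S.map g.op (x.eval p) :=
  NatTrans.naturality_apply (φ := x) g.op p

theorem eval_restrict (f : X ⟶ Y) (y : XType S Y) {n : C} (p : Tuple X n) :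
    (y.restrict f).eval p = y.eval (Tuple.map f p) := rfl

theorem restrict_comp (f : X ⟶ Y) (g : Y ⟶ Z) (z : XType S Z) :
    z.restrict (f ≫ g) = (z.restrict g).restrict f :=
  eval_injective fun n p => by simp only [eval_restrict, Tuple.map_comp]

theorem restrict_id (x : XType S X) : x.restrict (𝟙 X) = x :=
  eval_injective fun n p => by simp [eval_restrict, Tuple.map]

end XType

/-- The points `ξ a` exhibit the ind-object `X` as the formal colimit of the diagram `F`. -/
structure IsPresentation (X : Ind C) {A : Type v} [PartialOrder A] (F : A ⥤ C)
    (ξ : ∀ a, Tuple X (F.obj a)) : Prop where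
  compat : ∀ {a b : A} (h : a ≤ b), Tuple.precomp (F.map (homOfLE h)) (ξ b) = ξ a
  surj : ∀ {n : C} (p : Tuple X n), ∃ (a : A) (g : n ⟶ F.obj a), Tuple.precomp g (ξ a) = p
  desc : ∀ (H : Cᵒᵖ ⥤ Type v) (z : ∀ a, H.obj (op (F.obj a))),
    (∀ {a b : A} (h : a ≤ b), H.map (F.map (homOfLE h)).op (z b) = z a) →
      ∃ φ : (Ind.inclusion C).obj X ⟶ H, ∀ a, φ.app _ (ξ a) = z a

theorem IsPresentation.of_isColimit {X : Ind C} {A : Type v} [PartialOrder A] (F : A ⥤ C)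
    (ι : F ⋙ yoneda ⟶ (Functor.const A).obj ((Ind.inclusion C).obj X))
    (hι : IsColimit (Cocone.mk _ ι)) :
    IsPresentation X F (fun a => yonedaEquiv (ι.app a)) where
  compat {a b} h := by
    have hw : yoneda.map (F.map (homOfLE h)) ≫ ι.app b = ι.app a := by
      simpa using ι.naturality (homOfLE h)
    rw [← hw]
    exact yonedaEquiv_naturality _ _
  surj {n} p := by
    have h := isColimitOfPreserves ((evaluation Cᵒᵖ (Type v)).obj (op n)) hι
    obtain ⟨a, g, hg⟩ := Types.jointly_surjective_of_isColimit h p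
    exact ⟨a, g, (map_yonedaEquiv (ι.app a) g).trans hg⟩
  desc H z hz := by
    let c : Cocone (F ⋙ yoneda) := Cocone.mk H
      { app := fun a => yonedaEquiv.symm (z a)
        naturality := fun a b h => by
          have hab := yonedaEquiv_symm_naturality_left (F.map h) H (z b)
          dsimp
          rw [Category.comp_id, hab]
          exact congrArg _ (hz (leOfHom h)) }
    refine ⟨hι.desc c, fun a => ?_⟩
    have h : ι.app a ≫ hι.desc c = yonedaEquiv.symm (z a) := hι.fac c a
    rw [← yonedaEquiv_comp, h, Equiv.apply_symm_apply]

/-- A filtered index category admits a final functor from a directed poset, which puts the diagram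
in the form needed for the compactness argument. -/
theorem exists_isPresentation (X : Ind C) :
    ∃ (A : Type v) (_ : PartialOrder A) (_ : IsDirectedOrder A) (_ : Nonempty A) (F : A ⥤ C)
      (ξ : ∀ a, Tuple X (F.obj a)), IsPresentation X F ξ := by
  obtain ⟨A, _, _, _, G, _⟩ := IsFiltered.exists_directed X.presentation.I
  exact ⟨A, _, inferInstance, inferInstance, G ⋙ X.presentation.F, _, .of_isColimit _
    (Functor.whiskerLeft G X.presentation.ι)
    ((Functor.Final.isColimitWhiskerEquiv G _).symm X.presentation.isColimit)⟩

theorem exists_isPresentation_of_functor {A : Type v} [PartialOrder A] [IsDirectedOrder A]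
    [Nonempty A] (F : A ⥤ C) :
    ∃ (X : Ind C) (ξ : ∀ a, Tuple X (F.obj a)), IsPresentation X F ξ := by
  have e : F ⋙ Ind.yoneda ⋙ Ind.inclusion C ≅ F ⋙ yoneda :=
    Functor.isoWhiskerLeft F Ind.yonedaCompInclusion
  have h := isColimitOfPreserves (Ind.inclusion C) (colimit.isColimit (F ⋙ Ind.yoneda))
  exact ⟨colimit (F ⋙ Ind.yoneda), _, .of_isColimit F _
    ((IsColimit.precomposeInvEquiv e _).symm h)⟩

namespace IsPresentation

variable {X Y : Ind C} {S : Cᵒᵖ ⥤ KOrd.{v}} {A : Type v} [PartialOrder A] {F : A ⥤ C}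
  {ξ : ∀ a, Tuple X (F.obj a)}

theorem exists_hom (h : IsPresentation X F ξ) (z : ∀ a, Tuple Y (F.obj a))
    (hz : ∀ {a b : A} (h : a ≤ b), Tuple.precomp (F.map (homOfLE h)) (z b) = z a) :
    ∃ f : X ⟶ Y, ∀ a, Tuple.map f (ξ a) = z a := by
  obtain ⟨φ, hφ⟩ := h.desc ((Ind.inclusion C).obj Y) z hz
  refine ⟨(Ind.inclusion C).preimage φ, fun a => ?_⟩
  rw [Tuple.map, Functor.map_preimage, hφ]

theorem exists_xType (h : IsPresentation X F ξ) (z : ∀ a, S.obj (op (F.obj a)))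
    (hz : ∀ {a b : A} (h : a ≤ b), S.map (F.map (homOfLE h)).op (z b) = z a) :
    ∃ x : XType S X, ∀ a, x.eval (ξ a) = z a :=
  h.desc (S ⋙ forget KOrd.{v}) z hz

theorem xType_le (h : IsPresentation X F ξ) {x y : XType S X}
    (hxy : ∀ a, x.eval (ξ a) ≤ y.eval (ξ a)) : x ≤ y := by
  intro n p
  obtain ⟨a, g, rfl⟩ := h.surj p
  rw [XType.eval_precomp, XType.eval_precomp]
  exact KOrd.monotone_map S g (hxy a)

theorem xType_ext (h : IsPresentation X F ξ) {x y : XType S X}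
    (hxy : ∀ a, x.eval (ξ a) = y.eval (ξ a)) : x = y :=
  le_antisymm (h.xType_le fun a => (hxy a).le) (h.xType_le fun a => (hxy a).ge)

end IsPresentation

end Presentation

/-! ### Adding leaves to a tree -/

/-- The poset obtained from `I` by adding, for each `p : P`, a new maximal element above
`base p`. -/
inductive AddLeaves {I P : Type*} (base : P → I)
  | node (i : I) : AddLeaves base
  | leaf (p : P) : AddLeaves base

namespace AddLeaves

variable {I P : Type*} [PartialOrder I] {base : P → I}

instance : PartialOrder (AddLeaves base) where
  le
    | node i, node j => i ≤ j
    | node i, leaf p => i ≤ base p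
    | leaf _, node _ => False
    | leaf p, leaf q => p = q
  le_refl
    | node i => le_refl i
    | leaf _ => rfl
  le_trans
    | node i, node j, node k => fun (h : i ≤ j) (h' : j ≤ k) => h.trans h'
    | node i, node j, leaf p => fun (h : i ≤ j) (h' : j ≤ base p) => h.trans h'
    | node i, leaf p, leaf q => fun (h : i ≤ base p) (h' : p = q) => (h' ▸ h : i ≤ base q)
    | leaf _, leaf _, leaf _ => fun h h' => Eq.trans h h'
    | node _, leaf _, node _ => fun _ h' => h'.elim
    | leaf _, node _, _ => fun h => h.elim
    | leaf _, leaf _, node _ => fun _ h' => h'.elim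
  le_antisymm
    | node i, node j => fun (h : i ≤ j) (h' : j ≤ i) => congrArg node (le_antisymm h h')
    | node _, leaf _ => fun _ h' => h'.elim
    | leaf _, node _ => fun h => h.elim
    | leaf _, leaf _ => fun h _ => congrArg leaf h

/-- The embedding of the original poset. -/
def nodeEmbedding (base : P → I) : I ↪o AddLeaves base where
  toFun := node
  inj' _ _ h := by injection h
  map_rel_iff' := Iff.rfl

theorem isLowerSet_range_nodeEmbedding (base : P → I) :
    IsLowerSet (Set.range (nodeEmbedding base)) := by
  rintro _ (j | p) h ⟨i, rfl⟩
  · exact ⟨j, rfl⟩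
  · exact h.elim

theorem isRootedTree (hI : IsRootedTree I) (base : P → I) : IsRootedTree (AddLeaves base) where
  exists_root := by
    obtain ⟨r, hr⟩ := hI.exists_root
    refine ⟨node r, ?_⟩
    rintro (i | p)
    · exact hr i
    · exact hr (base p)
  isChain_Iic := by
    rintro (i | p) (j | q) hj (k | q') hk hne
    · exact (hI.isChain_Iic i).total hj hk
    · exact hk.elim
    · exact hj.elim
    · exact hj.elim
    · exact (hI.isChain_Iic (base p)).total (x := j) (y := k) hj hk
    · obtain rfl : q' = p := hk
      exact Or.inl hj
    · obtain rfl : q = p := hj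
      exact Or.inr hk
    · exact absurd (congrArg leaf (Eq.trans hj (Eq.symm hk))) hne

theorem monotone_iff {B : Type*} [Preorder B] {y : AddLeaves base → B} :
    Monotone y ↔ Monotone (fun i => y (node i)) ∧ ∀ p, y (node (base p)) ≤ y (leaf p) := by
  refine ⟨fun h => ⟨fun i j hij => h hij, fun p => h (le_refl (base p))⟩, ?_⟩
  rintro ⟨h, h'⟩ (i | p) (j | q) hle
  · exact h hle
  · exact (h hle).trans (h' q)
  · exact hle.elim
  · obtain rfl : p = q := hle
    exact le_rfl

end AddLeaves

/-! ### Solving finitely many problems by pushouts -/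

section FreeExtension

variable {C : Type u} [Category.{v} C]

/-- The morphism `u : a ⟶ b` is obtained by freely gluing the objects `cod p`, `p ∈ s`, to `a`
along the spans `cod p ⟵ dom p ⟶ a`. -/
structure IsFreeExtension {P : Type*} {dom cod : P → C} (f : ∀ p, dom p ⟶ cod p) (s : Finset P)
    {a b : C} (l : ∀ p ∈ s, dom p ⟶ a) (u : a ⟶ b) (q : ∀ p ∈ s, cod p ⟶ b) : Prop where
  comm : ∀ p hp, f p ≫ q p hp = l p hp ≫ u
  desc : ∀ {c : C} (v : a ⟶ c) (r : ∀ p ∈ s, cod p ⟶ c), (∀ p hp, f p ≫ r p hp = l p hp ≫ v) →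
    ∃ w : b ⟶ c, u ≫ w = v ∧ ∀ p hp, q p hp ≫ w = r p hp
  hom_ext : ∀ {c : C} (w w' : b ⟶ c), u ≫ w = u ≫ w' →
    (∀ p hp, q p hp ≫ w = q p hp ≫ w') → w = w'

theorem isFreeExtension_empty {P : Type*} {dom cod : P → C} (f : ∀ p, dom p ⟶ cod p) {a : C}
    (l : ∀ p ∈ (∅ : Finset P), dom p ⟶ a) :
    IsFreeExtension f ∅ l (𝟙 a) (fun p hp => absurd hp (Finset.notMem_empty p)) where
  comm p hp := absurd hp (Finset.notMem_empty p)
  desc v _ _ := ⟨v, Category.id_comp v, fun p hp => absurd hp (Finset.notMem_empty p)⟩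
  hom_ext w w' h _ := by simpa using h

theorem IsFreeExtension.insert {P : Type*} [DecidableEq P] {dom cod : P → C}
    {f : ∀ p, dom p ⟶ cod p} {s : Finset P} {p₀ : P} {a b c : C}
    {l : ∀ p ∈ insert p₀ s, dom p ⟶ a} {u : a ⟶ b} {q : ∀ p ∈ s, cod p ⟶ b}
    (h : IsFreeExtension f s (fun p hp => l p (Finset.mem_insert_of_mem hp)) u q)
    {inl : cod p₀ ⟶ c} {inr : b ⟶ c}
    (hpo : IsPushout (f p₀) (l p₀ (Finset.mem_insert_self p₀ s) ≫ u) inl inr)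
    {q' : ∀ p ∈ insert p₀ s, cod p ⟶ c} (hq₀ : q' p₀ (Finset.mem_insert_self p₀ s) = inl)
    (hq : ∀ p hp, q' p (Finset.mem_insert_of_mem hp) = q p hp ≫ inr) :
    IsFreeExtension f (insert p₀ s) l (u ≫ inr) q' where
  comm p hp := by
    rcases Finset.mem_insert.1 hp with rfl | hp'
    · rw [hq₀, hpo.w, Category.assoc]
    · rw [hq p hp', ← Category.assoc, h.comm, Category.assoc]
  desc {d} v r hr := by
    obtain ⟨w, hw, hw'⟩ := h.desc v (fun p hp => r p (Finset.mem_insert_of_mem hp))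
      fun p hp => hr p _
    refine ⟨hpo.desc (r p₀ (Finset.mem_insert_self p₀ s)) w
      (by rw [hr, Category.assoc, hw]), by simp [hw], fun p hp => ?_⟩
    rcases Finset.mem_insert.1 hp with rfl | hp'
    · simp [hq₀]
    · rw [hq p hp', Category.assoc, hpo.inr_desc, hw']
  hom_ext w w' hw hw' := by
    refine hpo.hom_ext ?_ (h.hom_ext _ _ (by simpa using hw) fun p hp => ?_)
    · simpa only [hq₀] using hw' p₀ (Finset.mem_insert_self p₀ s)
    · rw [← Category.assoc, ← Category.assoc, ← hq p hp]
      exact hw' p _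

/-- A problem posed by a point `point` over the extension `hom` to a family of types indexed by
`I` at `base`; it is either universal or existential. -/
structure ExtensionProblem (S : Cᵒᵖ ⥤ KOrd.{v}) (I : Type v) where
  base : I
  dom : C
  cod : C
  hom : dom ⟶ cod
  point : S.obj (op cod)
  universal : Prop

namespace ExtensionProblem

variable {S : Cᵒᵖ ⥤ KOrd.{v}} {I : Type v}

/-- The problem is posed at a point `x` of `S(dom)`. -/
def IsPosed (p : ExtensionProblem S I) (x : S.obj (op p.dom)) : Prop :=
  (¬ p.universal → S.map p.hom.op p.point ≤ x) ∧ (p.universal → x ≤ S.map p.hom.op p.point)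

/-- The problem is solved by points of `S(cod)` over the old and the new index. -/
def IsSolved (p : ExtensionProblem S I) (y z : S.obj (op p.cod)) : Prop :=
  (¬ p.universal → p.point ≤ y) ∧ (p.universal → z = p.point)

theorem isClosed_isSolved (p : ExtensionProblem S I) :
    IsClosed {y : S.obj (op p.cod) × S.obj (op p.cod) | p.IsSolved y.1 y.2} := by
  by_cases h : p.universal
  · simpa [IsSolved, h] using isClosed_eq continuous_snd continuous_const
  · simpa [IsSolved, h] using isClosed_le continuous_const continuous_fst

end ExtensionProblem

/-- Interpolation yields `e` satisfying two inequalities. In the existential case the one over `b`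
is raised to an equality, and `e'` is prescribed at the base node. In the universal case the one
over `cod` is raised, and `e'` is prescribed at the leaf. -/
theorem exists_solution_of_isPushout {S : Cᵒᵖ ⥤ KOrd.{v}} (hS : IsPolyadic S)
    (hco : IsCoBounded S) {I P : Type v} [PartialOrder I] (hI : IsRootedTree I)
    (prob : P → ExtensionProblem S I) (p : P) {b c : C} {l : (prob p).dom ⟶ b}
    {inl : (prob p).cod ⟶ c} {inr : b ⟶ c} (hpo : IsPushout (prob p).hom l inl inr)
    {y : AddLeaves (fun p => (prob p).base) → S.obj (op b)} (hy : Monotone y)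
    (hp : (prob p).IsPosed (S.map l.op (y (.node (prob p).base)))) :
    ∃ z : AddLeaves (fun p => (prob p).base) → S.obj (op c), Monotone z ∧
      (∀ i, S.map inr.op (z (.node i)) = y (.node i)) ∧
      (∀ p', p' ≠ p → S.map inr.op (z (.leaf p')) = y (.leaf p')) ∧
      (prob p).IsSolved (S.map inl.op (z (.node (prob p).base))) (S.map inl.op (z (.leaf p))) := by
  classical
  have lift : ∀ {y : AddLeaves (fun p => (prob p).base) → S.obj (op b)}, Monotone y →
      ∀ j e, S.map inr.op e = y j → ∃ z : AddLeaves (fun p => (prob p).base) → S.obj (op c),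
        Monotone z ∧ (∀ i, S.map inr.op (z i) = y i) ∧ z j = e := fun hy j e he =>
    (AddLeaves.isRootedTree hI _).exists_monotone_lift (KOrd.continuous_map S inr)
      (hS.exists_ge inr) (fun e a h => hco inr e a h) hy j e he
  by_cases h : (prob p).universal
  · obtain ⟨e, he, he'⟩ := hS.interpolation _ _ _ _ hpo.flip _ _ (hp.2 h)
    obtain ⟨e', hee', he''⟩ := hS.exists_ge inl e _ he'
    -- The old value at the leaf `p` may be discarded: the leaf is maximal, so its value only has to
    -- dominate the one at its base.
    obtain ⟨z, hz, hzy, hze⟩ := lift (y := Function.update y (.leaf p) (S.map inr.op e')) (by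
        rw [AddLeaves.monotone_iff] at hy ⊢
        refine ⟨by simpa using hy.1, fun p' => ?_⟩
        rcases eq_or_ne p' p with rfl | hne
        · simpa using he.trans (KOrd.monotone_map S inr hee')
        · simpa [hne] using hy.2 p')
      (.leaf p) e' (by simp)
    refine ⟨z, hz, fun i => by simp [hzy], fun p' hne => by simp [hzy, hne], ?_⟩
    exact ⟨fun h' => absurd h h', fun _ => by rw [hze, he'']⟩
  · obtain ⟨e, he, he'⟩ := hS.interpolation _ _ _ _ hpo _ _ (hp.1 h)
    obtain ⟨e', hee', he''⟩ := hS.exists_ge inr e _ he'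
    obtain ⟨z, hz, hzy, hze⟩ := lift hy _ e' he''
    refine ⟨z, hz, fun i => hzy _, fun p' _ => hzy _, ?_⟩
    exact ⟨fun _ => he.trans (hze ▸ KOrd.monotone_map S inl hee'), fun h' => absurd h' h⟩

/-- Problems are added one pushout at a time. Earlier solutions survive because the new family
restricts to the old one along `inr`, except at the leaf of the problem just added. -/
theorem exists_isFreeExtension [HasPushouts C] {S : Cᵒᵖ ⥤ KOrd.{v}} (hS : IsPolyadic S)
    (hco : IsCoBounded S) {I P : Type v} [PartialOrder I] (hI : IsRootedTree I)
    (prob : P → ExtensionProblem S I) (s : Finset P) {a : C} (l : ∀ p ∈ s, (prob p).dom ⟶ a) :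
    ∃ (b : C) (u : a ⟶ b) (q : ∀ p ∈ s, (prob p).cod ⟶ b),
      IsFreeExtension (fun p => (prob p).hom) s l u q ∧
      ∀ x : I → S.obj (op a), Monotone x →
        (∀ p hp, (prob p).IsPosed (S.map (l p hp).op (x (prob p).base))) →
        ∃ y : AddLeaves (fun p => (prob p).base) → S.obj (op b), Monotone y ∧
          (∀ i, S.map u.op (y (.node i)) = x i) ∧
          ∀ p hp, (prob p).IsSolved (S.map (q p hp).op (y (.node (prob p).base)))
            (S.map (q p hp).op (y (.leaf p))) := by
  classical
  induction s using Finset.induction with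
  | empty =>
    refine ⟨a, 𝟙 a, _, isFreeExtension_empty _ l, fun x hx _ => ?_⟩
    -- Before its problem is treated, a leaf copies the value at its base.
    refine ⟨fun j => match j with | .node i => x i | .leaf p => x (prob p).base,
      AddLeaves.monotone_iff.2 ⟨hx, fun p => le_rfl⟩, fun i => KOrd.map_id_apply S _, ?_⟩
    simp
  | insert p₀ s hp₀ ih =>
    obtain ⟨b, u, q, hfree, hb⟩ := ih fun p hp => l p (Finset.mem_insert_of_mem hp)
    have hpo := IsPushout.of_hasPushout (prob p₀).hom (l p₀ (Finset.mem_insert_self p₀ s) ≫ u)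
    generalize pushout.inl (prob p₀).hom (l p₀ (Finset.mem_insert_self p₀ s) ≫ u) = inl,
      pushout.inr (prob p₀).hom (l p₀ (Finset.mem_insert_self p₀ s) ≫ u) = inr at hpo
    obtain ⟨q', hq₀, hq⟩ : ∃ q' : ∀ p ∈ insert p₀ s, (prob p).cod ⟶ _,
        q' p₀ (Finset.mem_insert_self p₀ s) = inl ∧
        ∀ p hp, q' p (Finset.mem_insert_of_mem hp) = q p hp ≫ inr := by
      refine ⟨fun p hp => if h : p = p₀ then eqToHom (by rw [h]) ≫ inl else
        q p ((Finset.mem_insert.1 hp).resolve_left h) ≫ inr, by simp, fun p hp => ?_⟩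
      refine dif_neg ?_
      rintro rfl
      exact hp₀ hp
    refine ⟨_, _, q', hfree.insert hpo hq₀ hq, fun x hx hpos => ?_⟩
    obtain ⟨y, hy, hyx, hys⟩ := hb x hx fun p hp => hpos p _
    obtain ⟨z, hz, hzn, hzl, hzs⟩ := exists_solution_of_isPushout hS hco hI prob p₀ hpo hy (by
      rw [KOrd.map_comp_apply, hyx]
      exact hpos p₀ _)
    refine ⟨z, hz, fun i => by rw [KOrd.map_comp_apply, hzn, hyx], fun p hp => ?_⟩
    rcases Finset.mem_insert.1 hp with rfl | hp'
    · rwa [hq₀]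
    · rw [hq p hp', KOrd.map_comp_apply, KOrd.map_comp_apply, hzn, hzl]
      · exact hys p hp'
      · rintro rfl
        exact hp₀ hp'

end FreeExtension

/-! ### Solving all problems at once -/

section Solution

variable {C : Type u} [Category.{v} C]

theorem exists_isSolved [HasPushouts C] {S : Cᵒᵖ ⥤ KOrd.{v}} (hS : IsPolyadic S)
    (hco : IsCoBounded S) {X : Ind C} {I P : Type v} [PartialOrder I] (hI : IsRootedTree I)
    (x : I →o XType S X) (prob : P → ExtensionProblem S I) (pt : ∀ p, Tuple X (prob p).dom)
    (hpt : ∀ p, (prob p).IsPosed ((x (prob p).base).eval (pt p))) :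
    ∃ (Y : Ind C) (f : X ⟶ Y) (y : AddLeaves (fun p => (prob p).base) →o XType S Y),
      (∀ i, (y (.node i)).restrict f = x i) ∧
      ∀ p, ∃ q : Tuple Y (prob p).cod, Tuple.precomp (prob p).hom q = Tuple.map f (pt p) ∧
        (prob p).IsSolved ((y (.node (prob p).base)).eval q) ((y (.leaf p)).eval q) := by
  classical
  obtain ⟨A, _, _, _, F, ξ, hξ⟩ := exists_isPresentation X
  choose a l hl using fun p => hξ.surj (pt p)
  -- A stage is an object of the presentation with finitely many problems already posed over it.
  let A' := {c : A × Finset P // ∀ p ∈ c.2, a p ≤ c.1}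
  have : Nonempty A' := ⟨⟨(Classical.arbitrary A, ∅), by simp⟩⟩
  have : IsDirectedOrder A' := ⟨fun c d => by
    obtain ⟨e, hce, hde⟩ := exists_ge_ge c.1.1 d.1.1
    refine ⟨⟨(e, c.1.2 ∪ d.1.2), fun p hp => ?_⟩, ⟨hce, Finset.subset_union_left⟩,
      ⟨hde, Finset.subset_union_right⟩⟩
    rcases Finset.mem_union.1 hp with hp | hp
    · exact (c.2 p hp).trans hce
    · exact (d.2 p hp).trans hde⟩
  let l' : ∀ c : A', ∀ p ∈ c.1.2, (prob p).dom ⟶ F.obj c.1.1 :=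
    fun c p hp => l p ≫ F.map (homOfLE (c.2 p hp))
  have hl' : ∀ (c : A') p hp, Tuple.precomp (l' c p hp) (ξ c.1.1) = pt p := fun c p hp => by
    rw [Tuple.precomp_comp, hξ.compat, hl]
  have hF : ∀ {a b c : A} (h : a ≤ b) (h' : b ≤ c), F.map (homOfLE (h.trans h')) =
      F.map (homOfLE h) ≫ F.map (homOfLE h') := fun h h' => F.map_comp (homOfLE h) (homOfLE h')
  choose b u q hfree htypes using fun c : A' =>
    exists_isFreeExtension hS hco hI prob c.1.2 (l' c)
  -- Transition maps come from the universal property of free extensions, and its uniqueness part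
  -- makes them functorial, whatever order the problems were glued in.
  have hglue : ∀ c d : A', c ≤ d → ∃ w : b c ⟶ b d,
      (∀ h : c.1.1 ≤ d.1.1, u c ≫ w = F.map (homOfLE h) ≫ u d) ∧
        ∀ p hp hp', q c p hp ≫ w = q d p hp' := fun c d h => by
    obtain ⟨w, hw, hw'⟩ := (hfree c).desc (F.map (homOfLE h.1) ≫ u d)
      (fun p hp => q d p (h.2 hp)) fun p hp => by
        rw [(hfree d).comm]
        simp only [l', hF (c.2 p hp) h.1, Category.assoc]
    exact ⟨w, fun _ => hw, fun p hp _ => hw' p hp⟩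
  choose w hwu hwq using hglue
  let F' : A' ⥤ C :=
    { obj := b
      map := fun h => w _ _ (leOfHom h)
      map_id := fun c => (hfree c).hom_ext _ _ (by simp [hwu _ _ _ le_rfl])
        fun p hp => by simp [hwq _ _ _ p hp hp]
      map_comp := fun {c d e} h h' => (hfree c).hom_ext _ _
        (by
          have h₁ := leOfHom h
          have h₂ := leOfHom h'
          rw [← Category.assoc, hwu _ _ _ h₁.1, Category.assoc, hwu _ _ _ h₂.1,
            hwu _ _ _ (h₁.trans h₂).1, ← Category.assoc, ← F.map_comp, homOfLE_comp])
        fun p hp => by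
          have h₁ := leOfHom h
          have h₂ := leOfHom h'
          rw [← Category.assoc, hwq c d h₁ p hp (h₁.2 hp), hwq d e h₂ p _ (h₂.2 (h₁.2 hp)),
            hwq c e (h₁.trans h₂) p hp (h₂.2 (h₁.2 hp))] }
  obtain ⟨Y, ξ', hξ'⟩ := exists_isPresentation_of_functor F'
  let c₀ : A → A' := fun a => ⟨(a, ∅), by simp⟩
  obtain ⟨f, hf⟩ := hξ.exists_hom (fun a => Tuple.precomp (u (c₀ a)) (ξ' (c₀ a)))
    fun {a a'} h => by
      have hc : c₀ a ≤ c₀ a' := ⟨h, le_rfl⟩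
      rw [← Tuple.precomp_comp, ← hwu _ _ hc h, Tuple.precomp_comp]
      exact congrArg _ (hξ'.compat hc)
  have hf' : ∀ c : A', Tuple.map f (ξ c.1.1) = Tuple.precomp (u c) (ξ' c) := fun c => by
    have hc : c₀ c.1.1 ≤ c := ⟨le_rfl, Finset.empty_subset _⟩
    have h := hξ'.compat hc
    change Tuple.precomp (w _ _ hc) (ξ' c) = _ at h
    have hu : u (c₀ c.1.1) ≫ w _ _ hc = u c := (hwu _ _ hc le_rfl).trans
      ((congrArg (· ≫ u c) (F.map_id c.1.1)).trans (Category.id_comp _))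
    rw [hf, ← h, ← Tuple.precomp_comp, hu]
  obtain ⟨y, hyc, hy⟩ := exists_compatible_family
    (B := fun c : A' => AddLeaves (fun p => (prob p).base) → S.obj (op (b c)))
    (fun h y j => S.map (w _ _ h).op (y j))
    (fun h => continuous_pi fun j => (KOrd.continuous_map S _).comp (continuous_apply j))
    (fun {c d e} h h' y => funext fun j => by
      rw [← KOrd.map_comp_apply]
      exact congrArg (fun g => S.map (Quiver.Hom.op g) (y j)) (F'.map_comp (homOfLE h) (homOfLE h')).symm)
    (fun c => {y | Monotone y ∧ (∀ i, S.map (u c).op (y (.node i)) = (x i).eval (ξ c.1.1)) ∧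
      ∀ p hp, (prob p).IsSolved (S.map (q c p hp).op (y (.node (prob p).base)))
            (S.map (q c p hp).op (y (.leaf p)))})
    (fun c => by
      refine isClosed_monotone.inter (IsClosed.inter ?_ ?_)
      · change IsClosed {y : AddLeaves (fun p => (prob p).base) → S.obj (op (b c)) |
          ∀ i, S.map (u c).op (y (.node i)) = (x i).eval (ξ c.1.1)}
        simp only [Set.ofPred_forall]
        exact isClosed_iInter fun i => isClosed_eq
          ((KOrd.continuous_map S _).comp (continuous_apply _)) continuous_const
      · change IsClosed {y : AddLeaves (fun p => (prob p).base) → S.obj (op (b c)) |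
          ∀ p hp, (prob p).IsSolved (S.map (q c p hp).op (y (.node (prob p).base)))
            (S.map (q c p hp).op (y (.leaf p)))}
        simp only [Set.ofPred_forall]
        exact isClosed_iInter fun p => isClosed_iInter fun hp =>
          (prob p).isClosed_isSolved.preimage
            (((KOrd.continuous_map S (q c p hp)).comp
              (continuous_apply (AddLeaves.node (prob p).base))).prodMk
              ((KOrd.continuous_map S (q c p hp)).comp (continuous_apply (AddLeaves.leaf p)))))
    (fun c => htypes c (fun i => (x i).eval (ξ c.1.1)) (fun i j h => x.monotone h _ _)
      fun p hp => by
        rw [← XType.eval_precomp, hl' c p hp]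
        exact hpt p)
    (fun {c d} h y hy => by
      refine ⟨fun i j hij => KOrd.monotone_map S _ (hy.1 hij), fun i => ?_, fun p hp => ?_⟩
      · rw [← KOrd.map_comp_apply, hwu _ _ h h.1, KOrd.map_comp_apply, hy.2.1,
          ← XType.eval_precomp, hξ.compat]
      · rw [← KOrd.map_comp_apply, ← KOrd.map_comp_apply, hwq _ _ h p hp (h.2 hp)]
        exact hy.2.2 p _)
  choose y' hy' using fun j => hξ'.exists_xType (fun c => y c j)
    fun {c d} h => congrFun (hyc c d h) j
  refine ⟨Y, f, ⟨y', fun j j' h => hξ'.xType_le fun c => ?_⟩, fun i => hξ.xType_ext fun a => ?_,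
    fun p => ?_⟩
  · rw [hy', hy']
    exact (hy c).1 h
  · rw [XType.eval_restrict, hf, XType.eval_precomp]
    exact (congrArg _ (hy' _ _)).trans ((hy (c₀ a)).2.1 i)
  · let c : A' := ⟨(a p, {p}), by simp⟩
    have hp : p ∈ c.1.2 := Finset.mem_singleton_self p
    refine ⟨Tuple.precomp (q c p hp) (ξ' c), ?_, ?_⟩
    · rw [← Tuple.precomp_comp, (hfree c).comm, Tuple.precomp_comp, ← hf', ← Tuple.map_precomp,
        hl' c p hp]
    · rw [XType.eval_precomp, XType.eval_precomp]
      have h := (hy c).2.2 p hp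
      rwa [← hy', ← hy'] at h

/-- Every family of types indexed by a tree extends to a family indexed by a larger tree in which
all existential and universal problems posed by the given family are solved. -/
theorem exists_extension_solving [EssentiallySmall.{v} C] [HasPushouts C] {S : Cᵒᵖ ⥤ KOrd.{v}}
    (hS : IsPolyadic S) (hco : IsCoBounded S) {X : Ind C} {I : Type v} [PartialOrder I]
    (hI : IsRootedTree I) (x : I →o XType S X) :
    ∃ (Y : Ind C) (f : X ⟶ Y) (J : Type v) (_ : PartialOrder J) (ι : I ↪o J) (y : J →o XType S Y),
      IsRootedTree J ∧ IsLowerSet (Set.range ι) ∧ (∀ i, (y (ι i)).restrict f = x i) ∧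
      (∀ (i : I) {n m : C} (g : n ⟶ m) (p : Tuple X n) (t : S.obj (op m)),
        S.map g.op t ≤ (x i).eval p →
          ∃ q : Tuple Y m, Tuple.precomp g q = Tuple.map f p ∧ t ≤ (y (ι i)).eval q) ∧
      (∀ (i : I) {n m : C} (g : n ⟶ m) (p : Tuple X n) (t : S.obj (op m)),
        (x i).eval p ≤ S.map g.op t →
          ∃ j : J, ι i ≤ j ∧ ∃ q : Tuple Y m, Tuple.precomp g q = Tuple.map f p ∧
            (y j).eval q = t) := by
  let φ := (equivSmallModel.{v} C).inverse
  -- Objects are taken in a small model so that the problems form a type in `Type v`. The last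
  -- component marks a problem as universal or existential.
  let P₀ : Type v := Σ (_ : I) (n m : SmallModel.{v} C) (_ : φ.obj n ⟶ φ.obj m)
    (_ : Tuple X (φ.obj n)) (_ : S.obj (op (φ.obj m))), Prop
  let prob₀ : P₀ → ExtensionProblem S I := fun ⟨i, n, m, g, _, t, h⟩ =>
    ⟨i, φ.obj n, φ.obj m, g, t, h⟩
  let pt : ∀ p : P₀, Tuple X (prob₀ p).dom := fun ⟨_, _, _, _, p, _, _⟩ => p
  let P := {p : P₀ // (prob₀ p).IsPosed ((x (prob₀ p).base).eval (pt p))}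
  obtain ⟨Y, f, y, hy, hsol⟩ := exists_isSolved hS hco hI x (fun p : P => prob₀ p.1)
    (fun p => pt p.1) fun p => p.2
  -- An arbitrary problem is transported to the small model along `en` and `em`, and its solution is
  -- carried back along `em.inv`.
  have key : ∀ (i : I) {n m : C} (g : n ⟶ m) (p : Tuple X n) (t : S.obj (op m)) (U : Prop),
      (¬ U → S.map g.op t ≤ (x i).eval p) → (U → (x i).eval p ≤ S.map g.op t) →
      ∃ j, AddLeaves.node i ≤ j ∧ ∃ q : Tuple Y m, Tuple.precomp g q = Tuple.map f p ∧
        (¬ U → t ≤ (y (.node i)).eval q) ∧ (U → (y j).eval q = t) := by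
    intro i n m g p t U hE hU
    let en : φ.obj _ ≅ n := φ.objObjPreimageIso n
    let em : φ.obj _ ≅ m := φ.objObjPreimageIso m
    have hx : (x i).eval (Tuple.precomp en.hom p) = S.map en.hom.op ((x i).eval p) :=
      XType.eval_precomp _ _ _
    have ht : S.map (en.hom ≫ g ≫ em.inv).op (S.map em.hom.op t) =
        S.map en.hom.op (S.map g.op t) := by
      simp only [← KOrd.map_comp_apply, Category.assoc, Iso.inv_hom_id, Category.comp_id]
    let π : P := ⟨⟨i, _, _, en.hom ≫ g ≫ em.inv, Tuple.precomp en.hom p,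
      S.map em.hom.op t, U⟩, fun h => by
        change S.map (en.hom ≫ g ≫ em.inv).op (S.map em.hom.op t) ≤ _
        rw [ht]
        exact (KOrd.monotone_map S _ (hE h)).trans_eq hx.symm, fun h => by
        change _ ≤ S.map (en.hom ≫ g ≫ em.inv).op (S.map em.hom.op t)
        rw [ht]
        exact hx.trans_le (KOrd.monotone_map S _ (hU h))⟩
    obtain ⟨q, hq, hs⟩ := hsol π
    have hinv : S.map em.inv.op (S.map em.hom.op t) = t := by
      rw [← KOrd.map_comp_apply, Iso.inv_hom_id, KOrd.map_id_apply]
    refine ⟨.leaf π, le_refl i, Tuple.precomp em.inv q, ?_, fun h => ?_,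
      fun h => ?_⟩
    · change Tuple.precomp (en.hom ≫ g ≫ em.inv) q = Tuple.map f (Tuple.precomp en.hom p) at hq
      replace hq := congrArg (Tuple.precomp en.inv) hq
      rw [Tuple.map_precomp] at hq
      simpa only [← Tuple.precomp_comp, Iso.inv_hom_id_assoc, Iso.inv_hom_id,
        Tuple.precomp_id] using hq
    · rw [XType.eval_precomp, ← hinv]
      exact KOrd.monotone_map S _ (hs.1 h)
    · rw [XType.eval_precomp, ← hinv]
      exact congrArg _ (hs.2 h)
  refine ⟨Y, f, _, inferInstance, AddLeaves.nodeEmbedding _, y, AddLeaves.isRootedTree hI _,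
    AddLeaves.isLowerSet_range_nodeEmbedding _, hy, fun i n m g p t h => ?_,
    fun i n m g p t h => ?_⟩
  · obtain ⟨-, -, q, hq, hq', -⟩ := key i g p t False (fun _ => h) False.elim
    exact ⟨q, hq, hq' id⟩
  · obtain ⟨j, hj, q, hq, -, hq'⟩ := key i g p t True (fun h => absurd trivial h) fun _ => h
    exact ⟨j, hj, q, hq, hq' trivial⟩

end Solution

/-! ### Directed unions of trees -/

section DirectedUnion

variable {A : Type v} [PartialOrder A] [IsDirectedOrder A] {I : A → Type v}
  [∀ a, PartialOrder (I a)]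

/-- A point of a member of a family of types. -/
structure StagedPoint (I : A → Type v) where
  stage : A
  point : I stage

/-- The directed union of a system of order embeddings. -/
theorem exists_directed_union (e : ∀ {a b : A}, a ≤ b → I a ↪o I b)
    (he : ∀ {a b c : A} (h : a ≤ b) (h' : b ≤ c) (i : I a), e h' (e h i) = e (h.trans h') i) :
    ∃ (J : Type v) (_ : PartialOrder J) (c : ∀ a, I a ↪o J),
      (∀ {a b : A} (h : a ≤ b) (i : I a), c b (e h i) = c a i) ∧ ∀ j, ∃ a i, c a i = j := by
  have hle : ∀ {a b c d : A} (ha : a ≤ c) (hb : b ≤ c) (ha' : a ≤ d) (hb' : b ≤ d) {i : I a}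
      {j : I b}, e ha i ≤ e hb j → e ha' i ≤ e hb' j := by
    intro a b c d ha hb ha' hb' i j h
    obtain ⟨k, hk, hk'⟩ := exists_ge_ge c d
    rw [← (e hk').le_iff_le, he, he]
    rw [← (e hk).le_iff_le, he, he] at h
    exact h
  let _ : Preorder (StagedPoint I) :=
    { le := fun i j => ∃ (c : A) (ha : i.stage ≤ c) (hb : j.stage ≤ c), e ha i.point ≤ e hb j.point
      le_refl := fun i => ⟨i.stage, le_rfl, le_rfl, le_rfl⟩
      le_trans := by
        rintro i j k ⟨c, hi, hj, h⟩ ⟨d, hj', hk, h'⟩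
        obtain ⟨l, hl, hl'⟩ := exists_ge_ge c d
        exact ⟨l, hi.trans hl, hk.trans hl', (hle hi hj _ (hj.trans hl) h).trans
          (hle hj' hk _ _ h')⟩ }
  refine ⟨Antisymmetrization (StagedPoint I) (· ≤ ·), inferInstance, fun a =>
    OrderEmbedding.ofMapLEIff (fun i => toAntisymmetrization (· ≤ ·) ⟨a, i⟩) fun i j => ?_,
    fun {a b} h i => ?_, fun j => ?_⟩
  · rw [toAntisymmetrization_le_toAntisymmetrization_iff]
    refine ⟨fun ⟨c, ha, _, h⟩ => (e ha).le_iff_le.1 h, fun h => ⟨a, le_rfl, le_rfl, ?_⟩⟩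
    exact (e le_rfl).le_iff_le.2 h
  · refine Quotient.sound ⟨⟨b, le_rfl, h, ?_⟩, ⟨b, h, le_rfl, ?_⟩⟩
    · exact (he h le_rfl i).le
    · exact (he h le_rfl i).ge
  · obtain ⟨⟨a, i⟩, rfl⟩ := Quotient.exists_rep j
    exact ⟨a, i, rfl⟩

variable {e : ∀ {a b : A}, a ≤ b → I a ↪o I b} {J : Type v} [PartialOrder J] {c : ∀ a, I a ↪o J}

theorem isLowerSet_range_of_directed_union
    (hlow : ∀ {a b : A} (h : a ≤ b), IsLowerSet (Set.range (e h)))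
    (hc : ∀ {a b : A} (h : a ≤ b) (i : I a), c b (e h i) = c a i) (hsurj : ∀ j, ∃ a i, c a i = j)
    (a : A) : IsLowerSet (Set.range (c a)) := by
  rintro _ j hj ⟨i, rfl⟩
  obtain ⟨b, i', rfl⟩ := hsurj j
  obtain ⟨d, had, hbd⟩ := exists_ge_ge a b
  rw [← hc had, ← hc hbd, (c d).le_iff_le] at hj
  obtain ⟨k, hk⟩ := hlow had hj ⟨i, rfl⟩
  exact ⟨k, by rw [← hc had, hk, hc]⟩

/-- Down-closedness is what preserves trees: it keeps the root of one stage least at all later ones,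
and adds nothing below an existing point. -/
theorem IsRootedTree.of_directed_union [Nonempty A] (hI : ∀ a, IsRootedTree (I a))
    (hlow : ∀ {a b : A} (h : a ≤ b), IsLowerSet (Set.range (e h)))
    (hc : ∀ {a b : A} (h : a ≤ b) (i : I a), c b (e h i) = c a i)
    (hsurj : ∀ j, ∃ a i, c a i = j) : IsRootedTree J where
  exists_root := by
    obtain ⟨r, hr⟩ := (hI (Classical.arbitrary A)).exists_root
    refine ⟨c _ r, fun j => ?_⟩
    obtain ⟨b, i, rfl⟩ := hsurj j
    obtain ⟨d, had, hbd⟩ := exists_ge_ge (Classical.arbitrary A) b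
    obtain ⟨s, hs⟩ := (hI d).exists_root
    obtain ⟨k, rfl⟩ := hlow had (hs (e had r)) ⟨r, rfl⟩
    rw [← hc had, ← hc hbd]
    exact (c d).monotone (((e had).monotone (hr k)).trans (hs _))
  isChain_Iic j := by
    intro j₁ h₁ j₂ h₂ _
    obtain ⟨a, i, rfl⟩ := hsurj j
    obtain ⟨i₁, rfl⟩ := isLowerSet_range_of_directed_union hlow hc hsurj a h₁ ⟨i, rfl⟩
    obtain ⟨i₂, rfl⟩ := isLowerSet_range_of_directed_union hlow hc hsurj a h₂ ⟨i, rfl⟩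
    simp only [(c a).le_iff_le]
    exact ((hI a).isChain_Iic i).total ((c a).le_iff_le.1 h₁) ((c a).le_iff_le.1 h₂)

end DirectedUnion

/-! ### The category of type families and its directed colimits -/

section TypeFamily

variable {C : Type u} [Category.{v} C]

theorem Ind.exists_directed_colimit (S : Cᵒᵖ ⥤ KOrd.{v}) {A : Type v} [PartialOrder A]
    [IsDirectedOrder A] [Nonempty A] (X : A ⥤ Ind C) :
    ∃ (Y : Ind C) (f : ∀ a, X.obj a ⟶ Y), (∀ {a b : A} (h : a ≤ b), X.map (homOfLE h) ≫ f b = f a) ∧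
      (∀ {n : C} (p : Tuple Y n), ∃ a q, Tuple.map (f a) q = p) ∧
      ∀ x : ∀ a, XType S (X.obj a),
        (∀ {a b : A} (h : a ≤ b), (x b).restrict (X.map (homOfLE h)) = x a) →
          ∃ y : XType S Y, ∀ a, y.restrict (f a) = x a := by
  have h := isColimitOfPreserves (Ind.inclusion C) (colimit.isColimit X)
  refine ⟨colimit X, colimit.ι X, fun h => colimit.w X (homOfLE h), fun {n} p => ?_,
    fun x hx => ?_⟩
  · exact Types.jointly_surjective_of_isColimit
      (isColimitOfPreserves ((evaluation Cᵒᵖ (Type v)).obj (op n)) h) p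
  · let c : Cocone (X ⋙ Ind.inclusion C) := Cocone.mk (S ⋙ forget KOrd.{v})
      { app := x
        naturality := fun a b g => (hx (leOfHom g)).trans (Category.comp_id (x a)).symm }
    exact ⟨h.desc c, fun a => h.fac c a⟩

/-- An order-respecting family of types of an ind-object indexed by a tree. -/
structure TypeFamily (S : Cᵒᵖ ⥤ KOrd.{v}) where
  dom : Ind C
  index : Type v
  [order : PartialOrder index]
  isRootedTree : IsRootedTree index
  family : index →o XType S dom

namespace TypeFamily

variable {S : Cᵒᵖ ⥤ KOrd.{v}}

attribute [instance] order

/-- An extension of a family of types to a larger tree and a larger ind-object. -/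
@[ext]
structure Hom (T U : TypeFamily S) where
  hom : T.dom ⟶ U.dom
  emb : T.index ↪o U.index
  isLowerSet_range : IsLowerSet (Set.range emb)
  restrict_family : ∀ i, (U.family (emb i)).restrict hom = T.family i

noncomputable instance : Category (TypeFamily S) where
  Hom := Hom
  id T := ⟨𝟙 _, RelEmbedding.refl _, fun i j _ _ => ⟨j, rfl⟩, fun _ => XType.restrict_id _⟩
  comp {T U V} f g := ⟨f.hom ≫ g.hom, f.emb.trans g.emb, by
    rintro _ k hk ⟨i, rfl⟩
    obtain ⟨j, rfl⟩ := g.isLowerSet_range hk ⟨f.emb i, rfl⟩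
    obtain ⟨l, rfl⟩ := f.isLowerSet_range (g.emb.le_iff_le.1 hk) ⟨i, rfl⟩
    exact ⟨l, rfl⟩, fun i => by
      rw [XType.restrict_comp]
      exact (congrArg _ (g.restrict_family _)).trans (f.restrict_family i)⟩
  id_comp f := Hom.ext (Category.id_comp f.hom) rfl
  comp_id f := Hom.ext (Category.comp_id f.hom) rfl
  assoc f g h := Hom.ext (Category.assoc f.hom g.hom h.hom) rfl

/-- The underlying ind-object. -/
noncomputable def domFunctor (S : Cᵒᵖ ⥤ KOrd.{v}) : TypeFamily S ⥤ Ind C where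
  obj := dom
  map := Hom.hom

theorem emb_map {A : Type v} [PartialOrder A] (G : A ⥤ TypeFamily S) {a b c : A} (h : a ≤ b)
    (h' : b ≤ c) (i : (G.obj a).index) :
    (G.map (homOfLE h')).emb ((G.map (homOfLE h)).emb i) = (G.map (homOfLE (h.trans h'))).emb i :=
  (congrArg (fun g : G.obj a ⟶ G.obj c => g.emb i) (G.map_comp (homOfLE h) (homOfLE h'))).symm

theorem hom_map {A : Type v} [PartialOrder A] (G : A ⥤ TypeFamily S) {a b c : A} (h : a ≤ b)
    (h' : b ≤ c) :
    (G.map (homOfLE h)).hom ≫ (G.map (homOfLE h')).hom = (G.map (homOfLE (h.trans h'))).hom :=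
  (congrArg (fun g : G.obj a ⟶ G.obj c => g.hom) (G.map_comp (homOfLE h) (homOfLE h'))).symm

theorem exists_directed_colimit {A : Type v} [PartialOrder A] [IsDirectedOrder A] [Nonempty A]
    (G : A ⥤ TypeFamily S) :
    ∃ (T : TypeFamily S) (c : ∀ a, G.obj a ⟶ T),
      (∀ {a b : A} (h : a ≤ b), G.map (homOfLE h) ≫ c b = c a) ∧
      (∀ {n : C} (p : Tuple T.dom n), ∃ a q, Tuple.map (c a).hom q = p) ∧
      ∀ j : T.index, ∃ a i, (c a).emb i = j := by
  obtain ⟨Y, f, hf, hsurj, hdesc⟩ : ∃ (Y : Ind C) (f : ∀ a, (G.obj a).dom ⟶ Y),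
      (∀ {a b : A} (h : a ≤ b), (G.map (homOfLE h)).hom ≫ f b = f a) ∧
      (∀ {n : C} (p : Tuple Y n), ∃ a q, Tuple.map (f a) q = p) ∧
      ∀ x : ∀ a, XType S (G.obj a).dom,
        (∀ {a b : A} (h : a ≤ b), (x b).restrict (G.map (homOfLE h)).hom = x a) →
          ∃ y : XType S Y, ∀ a, y.restrict (f a) = x a :=
    Ind.exists_directed_colimit S (G ⋙ domFunctor S)
  obtain ⟨J, _, c, hc, hcsurj⟩ := exists_directed_union
    (fun {a b : A} (h : a ≤ b) => (G.map (homOfLE h)).emb) (emb_map G)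
  have hlow : ∀ {a b : A} (h : a ≤ b), IsLowerSet (Set.range (G.map (homOfLE h)).emb) :=
    fun h => (G.map (homOfLE h)).isLowerSet_range
  -- For an index `i` of stage `a`, the type it induces on stage `b` is read off at any common upper
  -- bound; the choice of bound is immaterial.
  have hindep : ∀ {a b d d' : A} (had : a ≤ d) (hbd : b ≤ d) (hdd' : d ≤ d') (i : (G.obj a).index),
      ((G.obj d).family ((G.map (homOfLE had)).emb i)).restrict (G.map (homOfLE hbd)).hom =
        ((G.obj d').family ((G.map (homOfLE (had.trans hdd'))).emb i)).restrict
          (G.map (homOfLE (hbd.trans hdd'))).hom := fun {a b d d'} had hbd hdd' i => by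
    rw [← hom_map G hbd hdd', XType.restrict_comp, ← emb_map G had hdd', Hom.restrict_family]
  have hz : ∀ a (i : (G.obj a).index), ∃ z : XType S Y, ∀ d (h : a ≤ d),
      z.restrict (f d) = (G.obj d).family ((G.map (homOfLE h)).emb i) := by
    intro a i
    choose ub ha hb using fun b : A => exists_ge_ge a b
    obtain ⟨z, hz⟩ := hdesc (fun b => ((G.obj (ub b)).family
      ((G.map (homOfLE (ha b))).emb i)).restrict (G.map (homOfLE (hb b))).hom) fun {b b'} h => by
        obtain ⟨d, hd, hd'⟩ := exists_ge_ge (ub b) (ub b')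
        rw [hindep (ha b) (hb b) hd i]
        rw [hindep (ha b') (hb b') hd' i, ← hom_map G h ((hb b').trans hd'), XType.restrict_comp]
    refine ⟨z, fun d h => (hz d).trans ?_⟩
    obtain ⟨d', hd, hd'⟩ := exists_ge_ge (ub d) d
    rw [hindep (ha d) (hb d) hd i, ← emb_map G h hd']
    exact Hom.restrict_family _ _
  choose z hz using hz
  have hzle : ∀ {a : A} {i j : (G.obj a).index}, i ≤ j → z a i ≤ z a j := by
    intro a i j hij n p
    obtain ⟨b, q, rfl⟩ := hsurj p
    obtain ⟨d, had, hbd⟩ := exists_ge_ge a b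
    rw [← hf hbd, Tuple.map_comp, ← XType.eval_restrict (f d) (z a i),
      ← XType.eval_restrict (f d) (z a j), hz a i d had,
      hz a j d had]
    exact (G.obj d).family.monotone ((G.map (homOfLE had)).emb.monotone hij) _ _
  have hzmap : ∀ {a b : A} (h : a ≤ b) (i : (G.obj a).index),
      z b ((G.map (homOfLE h)).emb i) = z a i := by
    intro a b h i
    refine XType.eval_injective fun n p => ?_
    obtain ⟨b', q, rfl⟩ := hsurj p
    obtain ⟨d, hbd, hd⟩ := exists_ge_ge b b'
    rw [← hf hd, Tuple.map_comp, ← XType.eval_restrict (f d) (z b _),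
      ← XType.eval_restrict (f d) (z a i), hz b _ d hbd,
      hz a i d (h.trans hbd), emb_map]
  choose ra ri hr using hcsurj
  -- The type attached to a point of the union does not depend on the chosen representative.
  have hy : ∀ a i, z (ra (c a i)) (ri (c a i)) = z a i := by
    intro a i
    obtain ⟨d, had, hd⟩ := exists_ge_ge a (ra (c a i))
    rw [← hzmap had, ← hzmap hd]
    refine congrArg _ ((c d).injective ?_)
    rw [hc, hc, hr]
  let T : TypeFamily S :=
    { dom := Y
      index := J
      isRootedTree := IsRootedTree.of_directed_union (fun a => (G.obj a).isRootedTree) hlow hc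
        fun j => ⟨_, _, hr j⟩
      family :=
        { toFun := fun j => z (ra j) (ri j)
          monotone' := fun j j' h => by
            obtain ⟨d, hd, hd'⟩ := exists_ge_ge (ra j) (ra j')
            change z (ra j) (ri j) ≤ z (ra j') (ri j')
            rw [← hzmap hd, ← hzmap hd']
            refine hzle ((c d).le_iff_le.1 ?_)
            rwa [hc, hc, hr, hr] } }
  refine ⟨T, fun a => ⟨f a, c a, isLowerSet_range_of_directed_union hlow hc
    (fun j => ⟨_, _, hr j⟩) a, fun i => ?_⟩, fun {a b} h => ?_, hsurj, fun j => ⟨_, _, hr j⟩⟩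
  · change (z (ra (c a i)) (ri (c a i))).restrict (f a) = _
    rw [hy, hz a i a le_rfl]
    exact congrArg (fun g : G.obj a ⟶ G.obj a => (G.obj a).family (g.emb i)) (G.map_id a)
  · exact Hom.ext (hf h) (RelEmbedding.ext fun i => hc h i)

/-- An extension of a family of types solving all existential and universal problems. -/
structure Hom.Solves {T U : TypeFamily S} (h : T ⟶ U) : Prop where
  existential : ∀ (i : T.index) {n m : C} (g : n ⟶ m) (p : Tuple T.dom n) (t : S.obj (op m)),
    S.map g.op t ≤ (T.family i).eval p → ∃ q : Tuple U.dom m,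
      Tuple.precomp g q = Tuple.map h.hom p ∧ t ≤ (U.family (h.emb i)).eval q
  universal : ∀ (i : T.index) {n m : C} (g : n ⟶ m) (p : Tuple T.dom n) (t : S.obj (op m)),
    (T.family i).eval p ≤ S.map g.op t → ∃ j : U.index, h.emb i ≤ j ∧ ∃ q : Tuple U.dom m,
      Tuple.precomp g q = Tuple.map h.hom p ∧ (U.family j).eval q = t

theorem exists_solves [EssentiallySmall.{v} C] [HasPushouts C] (hS : IsPolyadic S)
    (hco : IsCoBounded S) (T : TypeFamily S) : ∃ (U : TypeFamily S) (h : T ⟶ U), h.Solves := by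
  obtain ⟨Y, f, J, _, ι, y, hJ, hι, hy, hE, hU⟩ :=
    exists_extension_solving hS hco T.isRootedTree T.family
  exact ⟨⟨Y, J, hJ, y⟩, ⟨f, ι, hι, hy⟩, ⟨hE, hU⟩⟩

/-- By directedness a world and a tuple have representatives at a common stage, and `heval` shows
that the problem posed there is the same. -/
theorem isConstantDomainModel_of_directed_colimit {A : Type v} [PartialOrder A]
    [IsDirectedOrder A] {G : A ⥤ TypeFamily S} {T : TypeFamily S} {c : ∀ a, G.obj a ⟶ T}
    (hc : ∀ {a b : A} (h : a ≤ b), G.map (homOfLE h) ≫ c b = c a)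
    (hdom : ∀ {n : C} (p : Tuple T.dom n), ∃ a q, Tuple.map (c a).hom q = p)
    (hindex : ∀ j : T.index, ∃ a i, (c a).emb i = j)
    (hsol : ∀ a, ∃ (b : A) (h : a ≤ b), (G.map (homOfLE h)).Solves) :
    IsConstantDomainModel T.family := by
  have hmap : ∀ {a b : A} (h : a ≤ b) {n : C} (p : Tuple (G.obj a).dom n),
      Tuple.map (c b).hom (Tuple.map (G.map (homOfLE h)).hom p) = Tuple.map (c a).hom p :=
    fun {a b} h n p => by
      rw [← Tuple.map_comp, ← hc h]
      rfl
  have hemb : ∀ {a b : A} (h : a ≤ b) (i : (G.obj a).index),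
      (c b).emb ((G.map (homOfLE h)).emb i) = (c a).emb i := fun {a b} h i => by
    rw [← hc h]
    rfl
  have heval : ∀ (a : A) (i : (G.obj a).index) {n : C} (p : Tuple (G.obj a).dom n),
      (T.family ((c a).emb i)).eval (Tuple.map (c a).hom p) = ((G.obj a).family i).eval p :=
    fun a i n p => by rw [← XType.eval_restrict, Hom.restrict_family]
  have hrep : ∀ (j : T.index) {n : C} (p : Tuple T.dom n), ∃ (a : A) (i : (G.obj a).index)
      (q : Tuple (G.obj a).dom n), (c a).emb i = j ∧ Tuple.map (c a).hom q = p := by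
    intro j n p
    obtain ⟨a, i, rfl⟩ := hindex j
    obtain ⟨b, q, rfl⟩ := hdom p
    obtain ⟨d, had, hbd⟩ := exists_ge_ge a b
    exact ⟨d, _, _, hemb had i, hmap hbd q⟩
  constructor
  · intro j n m g p t h
    obtain ⟨a, i, p, rfl, rfl⟩ := hrep j p
    obtain ⟨b, hab, hs⟩ := hsol a
    rw [heval] at h
    obtain ⟨q, hq, hq'⟩ := hs.existential i g p t h
    refine ⟨Tuple.map (c b).hom q, ?_, ?_⟩
    · rw [← Tuple.map_precomp, hq, hmap]
    · rwa [← hemb hab, heval]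
  · intro j n m g p t h
    obtain ⟨a, i, p, rfl, rfl⟩ := hrep j p
    obtain ⟨b, hab, hs⟩ := hsol a
    rw [heval] at h
    obtain ⟨j, hj, q, hq, hq'⟩ := hs.universal i g p t h
    refine ⟨(c b).emb j, ?_, Tuple.map (c b).hom q, ?_, ?_⟩
    · rw [← hemb hab]
      exact (c b).emb.monotone hj
    · rw [← Tuple.map_precomp, hq, hmap]
    · rw [heval, hq']

theorem exists_isConstantDomainModel [EssentiallySmall.{v} C] [HasPushouts C] (hS : IsPolyadic S)
    (hco : IsCoBounded S) (T : TypeFamily S) :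
    ∃ (U : TypeFamily S) (_ : T ⟶ U), IsConstantDomainModel U.family := by
  choose next h hs using fun T : TypeFamily S => T.exists_solves hS hco
  let X : ℕ → TypeFamily S := fun k => Nat.rec T (fun _ => next) k
  let G : ℕ ⥤ TypeFamily S := Functor.ofSequence (X := X) fun k => h (X k)
  -- The chain is reindexed by `ULift ℕ`, since directed colimits are formed over posets in `Type
  -- v`.
  have hmono : Monotone (ULift.down : ULift.{v} ℕ → ℕ) := fun _ _ h => h
  obtain ⟨U, c, hc, hdom, hindex⟩ := exists_directed_colimit (hmono.functor ⋙ G)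
  refine ⟨U, c ⟨0⟩, isConstantDomainModel_of_directed_colimit hc hdom hindex fun k =>
    ⟨⟨k.down + 1⟩, Nat.le_succ _, ?_⟩⟩
  have := hs (X k.down)
  rwa [← Functor.ofSequence_map_homOfLE_succ (X := X) (fun k => h (X k)) k.down] at this

end TypeFamily

end TypeFamily

/-! ### The proposition and completeness -/

theorem mainTheorem11 {C : Type u} [Category.{v} C] [EssentiallySmall.{v} C] [HasPushouts C]
    (S : Cᵒᵖ ⥤ KOrd.{v}) (hS : IsPolyadic S) (hco : IsCoBounded S) :
    (∀ (X : Ind C) (I : Type v) [PartialOrder I], IsRootedTree I → ∀ x : I →o XType S X,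
      ∃ (Y : Ind C) (f : X ⟶ Y) (J : Type v) (_ : PartialOrder J) (ι : I ↪o J)
        (y : J →o XType S Y),
        IsRootedTree J ∧ IsLowerSet (Set.range ι) ∧ IsConstantDomainModel y ∧
          ∀ i : I, (y (ι i)).restrict f = x i) ∧
    (∀ (X : Ind C) (x : XType S X),
      ∃ (Y : Ind C) (f : X ⟶ Y) (J : Type v) (_ : PartialOrder J) (r : J)
        (y : J →o XType S Y),
        IsRootedTree J ∧ (∀ j : J, r ≤ j) ∧ IsConstantDomainModel y ∧
          (y r).restrict f = x) := by
  have key : ∀ (X : Ind C) (I : Type v) [PartialOrder I], IsRootedTree I → ∀ x : I →o XType S X,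
      ∃ (Y : Ind C) (f : X ⟶ Y) (J : Type v) (_ : PartialOrder J) (ι : I ↪o J)
        (y : J →o XType S Y),
        IsRootedTree J ∧ IsLowerSet (Set.range ι) ∧ IsConstantDomainModel y ∧
          ∀ i : I, (y (ι i)).restrict f = x i := by
    intro X I _ hI x
    obtain ⟨U, h, hU⟩ := TypeFamily.exists_isConstantDomainModel hS hco ⟨X, I, hI, x⟩
    exact ⟨U.dom, h.hom, U.index, U.order, h.emb, U.family, U.isRootedTree, h.isLowerSet_range,
      hU, h.restrict_family⟩
  refine ⟨key, fun X x => ?_⟩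
  obtain ⟨Y, f, J, _, ι, y, hJ, hι, hy, hyx⟩ := key X PUnit
    ⟨⟨⟨⟩, fun _ => le_rfl⟩, fun _ => Set.subsingleton_of_subsingleton.isChain⟩
    (OrderHom.const _ x)
  obtain ⟨r, hr⟩ := hJ.exists_root
  -- The image of the one-point tree is down-closed, so it contains the root of `J`.
  obtain ⟨i, rfl⟩ := hι (hr (ι ⟨⟩)) ⟨_, rfl⟩
  exact ⟨Y, f, J, _, ι i, y, hJ, hr, hy, hyx i⟩
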